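/- Let $K$ be an algebraically closed field of characteristic zero, let $G$ be a reductive linear algebraic group over $K$ (not necessarily connected; reductive means that the only closed connected unipotent normal subgroup of $G$ is the trivial one), let $X=\operatorname{Spec} A$ be an irreducible affine scheme of finite type over $K$ on which $G$ acts, and let $\pi\colon X\to X/\!\!/G=\operatorname{Spec}(A^G)$ be the natural map. The codimension of a closed subset is the infimum of the codimensions of the irreducible closed subsets contained in it ($+\infty$ for the empty set). Suppose that - $X$ has property $(S_2)$, that is, $\operatorname{depth}(\mathcal{O}_{X,Y})\ge\min(2,\operatorname{codim}_X Y)$ for every irreducible closed subset $Y$ of $X$, where $\mathcal{O}_{X,Y}$ is the local ring of $X$ at the generic point of $Y$; - $U$ is an open subscheme of $X/\!\!/G$ that is normal (all its local rings are integrally closed domains); - the complement $Z$ of $U$ has codimension at least $2$ in $X/\!\!/G$; - $\pi^{-1}(Z)$ has codimension at least $2$ in $X$. Then $X/\!\!/G$ is normal. -/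

import Mathlib

open AlgebraicGeometry CategoryTheory
open scoped TensorProduct MatrixGroups

noncomputable section

namespace QuotNormal

/-! ### Linear algebraic groups over an algebraically closed field

A linear algebraic group over an algebraically closed field `K` is a Zariski closed subgroup `G` of
`GL n K`. In characteristic zero every affine group scheme of finite type over `K` is reduced, so it
is of this form. -/

section Groups

variable {K : Type*} [Field K] {n : ℕ}

/-- Zariski closed subsets of `GL n K`: the common zero sets of families of polynomials in the
matrix entries. -/
def IsZariskiClosed (s : Set (GL (Fin n) K)) : Prop :=
  ∃ P : Set (MvPolynomial (Fin n × Fin n) K),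
    s = {g : GL (Fin n) K | ∀ p ∈ P, MvPolynomial.eval (fun ij => (g : Matrix (Fin n) (Fin n) K) ij.1 ij.2) p = 0}

/-- Connectedness in the Zariski topology (the empty set is allowed; it is applied to subgroups
only): `s` is not covered by two Zariski closed sets that both meet `s` and have no common point
in `s`. -/
def IsZariskiConnected (s : Set (GL (Fin n) K)) : Prop :=
  ∀ a b : Set (GL (Fin n) K), IsZariskiClosed a → IsZariskiClosed b →
    s ⊆ a ∪ b → s ∩ (a ∩ b) = ∅ → s ⊆ a ∨ s ⊆ b

/-- A group of matrices is unipotent if `g - 1` is nilpotent for each of its elements `g`. -/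
def IsUnipotentGroup (N : Subgroup (GL (Fin n) K)) : Prop :=
  ∀ g ∈ N, IsNilpotent ((g : Matrix (Fin n) (Fin n) K) - 1)

/-- A reductive group: a linear algebraic group `G` whose unipotent radical is trivial, that is, the
only closed connected unipotent normal subgroup of `G` is the trivial one. (As usual in
characteristic zero, `G` itself need not be connected.) -/
structure IsReductive (G : Subgroup (GL (Fin n) K)) : Prop where
  isZariskiClosed : IsZariskiClosed (G : Set (GL (Fin n) K))
  eq_bot_of_unipotent : ∀ N : Subgroup (GL (Fin n) K), N ≤ G → (N.subgroupOf G).Normal →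
    IsZariskiClosed (N : Set (GL (Fin n) K)) → IsZariskiConnected (N : Set (GL (Fin n) K)) →
    IsUnipotentGroup N → N = ⊥

/-- The coordinate ring `K[G]` of regular functions on `G`, generated by the matrix entries and the
inverse of the determinant. -/
def regularFunctions (G : Subgroup (GL (Fin n) K)) : Subalgebra K (G → K) :=
  Algebra.adjoin K
    (Set.range (fun (ij : Fin n × Fin n) (g : G) =>
        ((g : GL (Fin n) K) : Matrix (Fin n) (Fin n) K) ij.1 ij.2) ∪
      {fun g : G => (((g : GL (Fin n) K) : Matrix (Fin n) (Fin n) K).det)⁻¹})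

/-- Evaluation of regular functions at a point `g` of `G`. -/
def evalAt (G : Subgroup (GL (Fin n) K)) (g : G) : regularFunctions G →ₐ[K] K :=
  (Pi.evalAlgHom K (fun _ : G => K) g).comp (regularFunctions G).val

variable {A : Type*} [CommRing A] [Algebra K A]

/-- Let `α : G × X → X` be a morphism, where `X = Spec A`, with comorphism `ρ : A → A ⊗ K[G]`.
For `g` in `G` this is the comorphism `A → A` of the morphism `α(g, -) : X → X`. -/
def comorphismAt {G : Subgroup (GL (Fin n) K)} (ρ : A →ₐ[K] A ⊗[K] regularFunctions G) (g : G) :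
    A →ₐ[K] A :=
  ((Algebra.TensorProduct.rid K K A).toAlgHom.comp
    (Algebra.TensorProduct.map (AlgHom.id K A) (evalAt G g))).comp ρ

/-- An action of the algebraic group `G` on the affine `K`-scheme `X = Spec A`, given by the
comorphism `A → A ⊗ K[G]` of a morphism `α : G × X → X` of `K`-schemes with
`α(1, -) = id` and `α(gh, -) = α(g, -) ∘ α(h, -)`. (As `G` is a variety over an algebraically
closed field, it is enough to impose the two laws at the points of `G`.) -/
structure Action (G : Subgroup (GL (Fin n) K)) (A : Type*) [CommRing A] [Algebra K A] where
  coaction : A →ₐ[K] A ⊗[K] regularFunctions G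
  comorphismAt_one : comorphismAt coaction 1 = AlgHom.id K A
  comorphismAt_mul : ∀ g h : G,
    comorphismAt coaction (g * h) = (comorphismAt coaction h).comp (comorphismAt coaction g)

/-- The algebra `A ^ G` of invariant functions: those `a` in `A` whose pullbacks along the action
`G × X → X` and along the projection `G × X → X` agree. -/
def Action.invariants {G : Subgroup (GL (Fin n) K)} (α : Action G A) : Subalgebra K A :=
  AlgHom.equalizer α.coaction Algebra.TensorProduct.includeLeft

end Groups

section Quotient

universe u v

variable {K : Type v} [Field K] {n : ℕ} {G : Subgroup (GL (Fin n) K)}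
  {A : Type u} [CommRing A] [Algebra K A]

/-- The quotient scheme `X // G = Spec (A ^ G)`, where `X = Spec A`. -/
def Action.quotient (α : Action G A) : Scheme.{u} := Spec (CommRingCat.of α.invariants)

/-- The natural map `π : X → X // G`. -/
def Action.quotientMap (α : Action G A) : Spec (CommRingCat.of A) ⟶ α.quotient :=
  Spec.map (CommRingCat.ofHom (algebraMap α.invariants A))

end Quotient

/-! ### Normality, codimension, depth and the condition `(S_i)` -/

section Schemes

universe u

/-- A scheme is normal if all its local rings are integrally closed domains. -/
def IsNormalScheme (X : Scheme.{u}) : Prop :=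
  ∀ x : X, IsDomain (X.presheaf.stalk x) ∧ IsIntegrallyClosed (X.presheaf.stalk x)

/-- The codimension of a closed subset `Z` of a scheme `X`: the infimum of the codimensions of its
irreducible closed subsets, that is, of the closures of its points `z`. The codimension of the
closure of `z` is the supremum of the lengths of the chains of irreducible closed subsets that
start with it, and is the coheight of `z` in the specialization order. The empty set has
codimension `⊤`. -/
def codim {X : Scheme.{u}} (Z : Set X) : ℕ∞ := ⨅ z ∈ Z, Order.coheight z

/-- The depth of a local ring: the supremum of the lengths of the regular sequences in its maximal
ideal. -/
def depth (R : Type*) [CommRing R] [IsLocalRing R] : ℕ∞ :=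
  ⨆ (rs : List R) (_ : (∀ r ∈ rs, r ∈ IsLocalRing.maximalIdeal R) ∧
    RingTheory.Sequence.IsRegular R rs), (rs.length : ℕ∞)

/-- Serre's condition `(S_i)`: the local ring of `X` along every irreducible closed subset `Z` has
depth at least `min i (codim Z)`. Here `Z` is given by its generic point `x`, and the local ring of
`X` along `Z` is the stalk at `x`. -/
def SatisfiesS (i : ℕ) (X : Scheme.{u}) : Prop :=
  ∀ x : X, min (i : ℕ∞) (codim (closure {x} : Set X)) ≤ depth (X.presheaf.stalk x)

end Schemes

end QuotNormal

end

/-!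
Serre's condition `(S_2)` on `X = Spec A` says, in terms of associated primes: `A` has no embedded
primes, and a principal ideal generated by a nonzerodivisor has associated primes of codimension one
only. Hence, for a nonzerodivisor `b`, a fraction `a / b` lies in `A` as soon as it is regular
outside a closed set of codimension at least two. A fraction `a / b` of `A ^ G` that is regular on
`U` is regular on the preimage of `U`, hence lies in `A`, and a quotient of invariants is invariant.
So `A ^ G` is the intersection of the local rings of `U`, which are integrally closed. It is a
domain because the image of the generic point of `X` lies in `U` and `A ^ G` embeds into the local
ring there.
-/

namespace QuotNormal

open IsLocalRing nonZeroDivisors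

section Quotient

variable {R : Type*} [CommRing R]

theorem mem_colon_singleton_mk_iff {b p u : R} :
    p ∈ (⊥ : Submodule R (R ⧸ Ideal.span {b})).colon {Ideal.Quotient.mk _ u} ↔ b ∣ p * u := by
  rw [Submodule.mem_colon_singleton, Submodule.mem_bot, ← Ideal.Quotient.eq_zero_iff_dvd, map_mul]
  rfl

theorem dvd_of_dvd_mul_of_isSMulRegular_quotSMulTop {x y v : R}
    (hy : IsSMulRegular (QuotSMulTop x R) y) (h : x ∣ y * v) : x ∣ v := by
  have mk_eq_zero (r : R) : (Submodule.Quotient.mk r : QuotSMulTop x R) = 0 ↔ x ∣ r := by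
    rw [Submodule.Quotient.mk_eq_zero, Submodule.mem_smul_pointwise_iff_exists]
    simp [dvd_def, eq_comm]
  rw [← mk_eq_zero] at h ⊢
  exact hy.right_eq_zero_of_smul h

end Quotient

section Depth

variable {R : Type*} [CommRing R] [IsLocalRing R]

theorem exists_isSMulRegular_of_one_le_depth (h : 1 ≤ depth R) :
    ∃ x ∈ maximalIdeal R, IsSMulRegular R x := by
  by_contra! hc
  suffices depth R = 0 by simp [this] at h
  simp only [depth, ENat.iSup_eq_zero, Nat.cast_eq_zero, List.length_eq_zero_iff]
  rintro (_ | ⟨x, rs⟩) ⟨hmem, hreg⟩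
  · rfl
  · rw [RingTheory.Sequence.isRegular_cons_iff] at hreg
    exact absurd hreg.1 (hc x (hmem x (by simp)))

theorem exists_isSMulRegular_pair_of_two_le_depth (h : 2 ≤ depth R) :
    ∃ x ∈ maximalIdeal R, ∃ y ∈ maximalIdeal R,
      IsSMulRegular R x ∧ IsSMulRegular (QuotSMulTop x R) y := by
  by_contra! hc
  suffices depth R ≤ 1 from absurd (h.trans this) (by decide)
  refine iSup₂_le ?_
  rintro (_ | ⟨x, _ | ⟨y, rs⟩⟩) ⟨hmem, hreg⟩
  · simp
  · simp
  · simp only [RingTheory.Sequence.isRegular_cons_iff] at hreg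
    exact absurd hreg.2.1 (hc x (hmem x (by simp)) y (hmem y (by simp)) hreg.1)

theorem dvd_of_forall_dvd_mul_of_two_le_depth (h : 2 ≤ depth R) {b u : R} (hb : b ∈ R⁰)
    (hu : ∀ p ∈ maximalIdeal R, b ∣ p * u) : b ∣ u := by
  obtain ⟨x, hx, y, hy, hxr, hyr⟩ := exists_isSMulRegular_pair_of_two_le_depth h
  obtain ⟨v, hv⟩ := hu x hx
  obtain ⟨t, ht⟩ := hu y hy
  have hyv : y * v = x * t :=
    (mul_cancel_left_mem_nonZeroDivisors hb).1 (by linear_combination (-y) * hv + x * ht)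
  obtain ⟨w, rfl⟩ := dvd_of_dvd_mul_of_isSMulRegular_quotSMulTop hyr ⟨t, hyv⟩
  exact ⟨w, hxr (show x * u = x * (b * w) by rw [hv]; ring)⟩

variable [IsNoetherianRing R]

theorem not_isAssociatedPrime_maximalIdeal_of_one_le_depth (h : 1 ≤ depth R) :
    ¬ IsAssociatedPrime (maximalIdeal R) R := fun hm => by
  obtain ⟨x, hx, hreg⟩ := exists_isSMulRegular_of_one_le_depth h
  obtain ⟨-, u, hu⟩ := isAssociatedPrime_iff.1 hm
  have hxu : x • u = 0 := by rwa [hu, Submodule.mem_colon_singleton, Submodule.mem_bot] at hx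
  apply hm.isPrime.ne_top
  simp [hu, hreg.right_eq_zero_of_smul hxu]

theorem not_isAssociatedPrime_maximalIdeal_quotient_span_singleton (h : 2 ≤ depth R) {b : R}
    (hb : b ∈ R⁰) : ¬ IsAssociatedPrime (maximalIdeal R) (R ⧸ Ideal.span {b}) := fun hm => by
  obtain ⟨-, w, hw⟩ := isAssociatedPrime_iff.1 hm
  obtain ⟨u, rfl⟩ := Ideal.Quotient.mk_surjective w
  have hu : b ∣ u := dvd_of_forall_dvd_mul_of_two_le_depth h hb fun p hp =>
    mem_colon_singleton_mk_iff.1 (hw ▸ hp)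
  apply hm.isPrime.ne_top
  rw [Ideal.eq_top_iff_one, hw, mem_colon_singleton_mk_iff, one_mul]
  exact hu

end Depth

section Localization

variable {A S : Type*} [CommRing A] [CommRing S] [Algebra A S] [IsLocalRing S]
  {P : Ideal A} [P.IsPrime] [IsLocalization.AtPrime S P]

open Module in
theorem isAssociatedPrime_maximalIdeal_of_isLocalizedModule {M N : Type*} [AddCommGroup M]
    [Module A M] [AddCommGroup N] [Module A N] [Module S N] [IsScalarTower A S N]
    (f : M →ₗ[A] N) [IsLocalizedModule P.primeCompl f] (h : IsAssociatedPrime P M) :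
    IsAssociatedPrime (maximalIdeal S) N := by
  apply associatedPrimes.mem_associatedPrimes_of_comap_mem_associatedPrimes_of_isLocalizedModule
    P.primeCompl f
  rwa [← Ideal.under_def, IsLocalization.AtPrime.under_maximalIdeal S P]

variable (S) [IsNoetherianRing A]

theorem not_isAssociatedPrime_of_one_le_depth (h : 1 ≤ depth S) : ¬ IsAssociatedPrime P A := by
  have : IsNoetherianRing S := IsLocalization.isNoetherianRing P.primeCompl S inferInstance
  exact fun hP => not_isAssociatedPrime_maximalIdeal_of_one_le_depth h
    (isAssociatedPrime_maximalIdeal_of_isLocalizedModule (Algebra.linearMap A S) hP)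

theorem not_isAssociatedPrime_quotient_span_singleton (h : 2 ≤ depth S) {b : A} (hb : b ∈ A⁰) :
    ¬ IsAssociatedPrime P (A ⧸ Ideal.span {b}) := fun hP => by
  have : IsNoetherianRing S := IsLocalization.isNoetherianRing P.primeCompl S inferInstance
  have hbS : algebraMap A S b ∈ S⁰ :=
    IsLocalization.map_nonZeroDivisors_le P.primeCompl S (Submonoid.mem_map_of_mem _ hb)
  have hm := isAssociatedPrime_maximalIdeal_of_isLocalizedModule (S := S)
    ((Ideal.span {b}).toLocalizedQuotient' S P.primeCompl (Algebra.linearMap A S)) hP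
  rw [Ideal.localized'_eq_map, Ideal.map_span, Set.image_singleton] at hm
  exact not_isAssociatedPrime_maximalIdeal_quotient_span_singleton h hbS hm

end Localization

theorem isIntegrallyClosed_of_forall_dvd {B : Type*} [CommRing B] [IsDomain B]
    (T : Set (PrimeSpectrum B)) (hT : ∀ p ∈ T, IsIntegrallyClosed (Localization.AtPrime p.asIdeal))
    (hdvd : ∀ a b : B, b ≠ 0 → (∀ p ∈ T, ∃ s ∉ p.asIdeal, b ∣ s * a) → b ∣ a) :
    IsIntegrallyClosed B := by
  refine IsIntegrallyClosed.of_localization T hT (eq_bot_iff.2 fun x hx => ?_)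
  obtain ⟨a, b, rfl⟩ := IsLocalization.exists_mk'_eq B⁰ x
  obtain ⟨c, hc⟩ := hdvd a b (nonZeroDivisors.ne_zero b.2) fun p hp => by
    simp only [Algebra.mem_iInf] at hx
    obtain ⟨d, s, hs, hds⟩ := hx p hp
    rw [IsLocalization.mk'_eq_iff_eq, (IsFractionRing.injective B _).eq_iff] at hds
    exact ⟨s, hs, d, hds⟩
  exact ⟨c, by simp [hc]⟩

section Invariants

variable {K : Type*} [Field K] {n : ℕ} {G : Subgroup (GL (Fin n) K)}
  {A : Type*} [CommRing A] [Algebra K A]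

theorem Action.dvd_of_coe_dvd_coe (α : Action G A) {a b : α.invariants} (hb : (b : A) ∈ A⁰)
    (hab : (b : A) ∣ a) : b ∣ a := by
  obtain ⟨c, hc⟩ := hab
  have coaction_coe (d : α.invariants) : α.coaction d = (d : A) ⊗ₜ 1 := d.2
  have hreg : IsSMulRegular (A ⊗[K] regularFunctions G) (b : A) :=
    Module.Flat.isSMulRegular_of_nonZeroDivisors (M := A ⊗[K] regularFunctions G) hb
  have hinv : α.coaction c = c ⊗ₜ 1 := hreg <| calc
    (b : A) • α.coaction c = α.coaction (b * c) := by
      rw [map_mul, coaction_coe]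
      exact Algebra.smul_def (A := A ⊗[K] regularFunctions G) _ _
    _ = (b : A) • (c ⊗ₜ 1) := by
      rw [← hc, coaction_coe, hc, TensorProduct.smul_tmul', smul_eq_mul]
  exact ⟨⟨c, hinv⟩, Subtype.ext hc⟩

end Invariants

section Schemes

universe u

variable {X : Scheme.{u}}

theorem one_le_codim_iff {Z : Set X} : 1 ≤ codim Z ↔ ∀ z ∈ Z, ¬ IsMax z := by
  simp only [codim, le_iInf_iff, Order.one_le_iff_pos, Order.coheight_pos]

theorem codim_mono {Z W : Set X} (h : Z ⊆ W) : codim W ≤ codim Z :=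
  biInf_mono h

theorem isMax_of_codim_closure_lt_one {x : X} (hx : codim (closure {x} : Set X) < 1) :
    IsMax x := by
  contrapose! hx
  exact one_le_codim_iff.2 fun z hz hmax => hx (hmax.mono (specializes_iff_mem_closure.2 hz))

theorem isMax_genericPoint [IrreducibleSpace X] : IsMax (genericPoint X) :=
  fun y _ => genericPoint_specializes y

theorem SatisfiesS.mono {i j : ℕ} (hij : i ≤ j) (hS : SatisfiesS j X) : SatisfiesS i X :=
  fun x => (min_le_min_right _ (by exact_mod_cast hij)).trans (hS x)

theorem IsNormalScheme.stalk_of_mem {U : X.Opens} (hU : IsNormalScheme U) {x : X} (hx : x ∈ U) :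
    IsDomain (X.presheaf.stalk x) ∧ IsIntegrallyClosed (X.presheaf.stalk x) := by
  obtain ⟨_, _⟩ := hU ⟨x, hx⟩
  let e : U.toScheme.presheaf.stalk ⟨x, hx⟩ ≃+* X.presheaf.stalk x :=
    (U.stalkIso ⟨x, hx⟩).commRingCatIsoToRingEquiv
  exact ⟨e.symm.toMulEquiv.isDomain _, IsIntegrallyClosed.of_equiv e⟩

end Schemes

section Spec

universe u

variable {A B : CommRingCat.{u}}

theorem le_iff_asIdeal_le {x y : Spec A} : x ≤ y ↔ y.asIdeal ≤ x.asIdeal :=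
  (PrimeSpectrum.le_iff_specializes (y : PrimeSpectrum A) x).symm

instance isPrime_asIdeal (x : Spec A) : x.asIdeal.IsPrime := x.isPrime

theorem asIdeal_genericPoint [IrreducibleSpace (Spec A)] :
    (genericPoint (Spec A)).asIdeal = nilradical A := by
  refine le_antisymm ?_ (nilradical_le_prime _)
  rw [nilradical_eq_sInf]
  exact le_sInf fun p hp =>
    le_iff_asIdeal_le.1 (genericPoint_specializes (α := Spec A) ⟨p, hp⟩)

/-- The localization map from `A` to the local ring of `Spec A` at `x`. -/
noncomputable instance algebraStalk (x : Spec A) : Algebra A ((Spec A).presheaf.stalk x) :=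
  StructureSheaf.stalkAlgebra A x

instance isLocalization_stalk (x : Spec A) :
    IsLocalization.AtPrime ((Spec A).presheaf.stalk x) x.asIdeal :=
  StructureSheaf.IsLocalization.to_stalk A x

theorem isNormalScheme_spec_of_isIntegrallyClosed [IsDomain B] [IsIntegrallyClosed B] :
    IsNormalScheme (Spec B) :=
  fun x => ⟨IsLocalization.isDomain_of_le_nonZeroDivisors (M := x.asIdeal.primeCompl) _
      x.asIdeal.primeCompl_le_nonZeroDivisors,
    isIntegrallyClosed_of_isLocalization _ x.asIdeal.primeCompl
      x.asIdeal.primeCompl_le_nonZeroDivisors⟩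

section Serre

variable [IsNoetherianRing A]

theorem SatisfiesS.isMax_of_isAssociatedPrime (hS : SatisfiesS 1 (Spec A)) {x : Spec A}
    (hx : IsAssociatedPrime x.asIdeal A) : IsMax x := by
  refine isMax_of_codim_closure_lt_one (lt_of_not_ge fun hcodim => ?_)
  exact not_isAssociatedPrime_of_one_le_depth _ ((le_min le_rfl hcodim).trans (hS x)) hx

theorem SatisfiesS.codim_closure_lt_two_of_isAssociatedPrime (hS : SatisfiesS 2 (Spec A)) {b : A}
    (hb : b ∈ A⁰) {x : Spec A} (hx : IsAssociatedPrime x.asIdeal (A ⧸ Ideal.span {b})) :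
    codim (closure {x} : Set (Spec A)) < 2 := by
  refine lt_of_not_ge fun hcodim => ?_
  exact not_isAssociatedPrime_quotient_span_singleton _ ((le_min le_rfl hcodim).trans (hS x)) hb hx

theorem SatisfiesS.mem_nonZeroDivisors_of_not_isNilpotent [IrreducibleSpace (Spec A)]
    (hS : SatisfiesS 1 (Spec A)) {s : A} (hs : ¬ IsNilpotent s) : s ∈ A⁰ := by
  by_contra h
  have hmem : s ∈ ⋃ p ∈ associatedPrimes A A, (p : Set A) := by
    rwa [biUnion_associatedPrimes_eq_compl_nonZeroDivisors]
  simp only [Set.mem_iUnion] at hmem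
  obtain ⟨P, hP, hsP⟩ := hmem
  have hmax := hS.isMax_of_isAssociatedPrime (x := ⟨P, hP.isPrime⟩) hP
  have hle : P ≤ (genericPoint (Spec A)).asIdeal :=
    le_iff_asIdeal_le.1 (hmax (genericPoint_specializes _))
  rw [asIdeal_genericPoint] at hle
  exact hs (hle hsP)

theorem SatisfiesS.dvd_of_forall_exists_notMem_dvd_mul (hS : SatisfiesS 2 (Spec A))
    {Z : Set (Spec A)} (hZc : IsClosed Z) (hZ : 2 ≤ codim Z) {a b : A} (hb : b ∈ A⁰)
    (h : ∀ x ∉ Z, ∃ s ∉ x.asIdeal, b ∣ s * a) : b ∣ a := by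
  by_contra hab
  have ha : Ideal.Quotient.mk (Ideal.span {b}) a ≠ 0 := by
    rwa [Ne, Ideal.Quotient.eq_zero_iff_dvd]
  obtain ⟨P, hP, hle⟩ := exists_le_isAssociatedPrime_of_isNoetherianRing A _ ha
  let x : Spec A := ⟨P, hP.isPrime⟩
  have hx : x ∉ Z := fun hx => (hS.codim_closure_lt_two_of_isAssociatedPrime hb (x := x) hP).not_ge
    (hZ.trans (codim_mono (hZc.closure_subset_iff.2 (by simpa))))
  obtain ⟨s, hs, hsa⟩ := h x hx
  exact hs (hle (mem_colon_singleton_mk_iff.2 hsa))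

end Serre

section Descent

theorem isIntegrallyClosed_of_isNormalScheme_of_forall_dvd [IsDomain B] {U : (Spec B).Opens}
    (hU : IsNormalScheme U)
    (hdvd : ∀ a b : B, b ≠ 0 → (∀ y ∈ U, ∃ s ∉ y.asIdeal, b ∣ s * a) → b ∣ a) :
    IsIntegrallyClosed B := by
  refine isIntegrallyClosed_of_forall_dvd (U : Set (Spec B)) (fun (y : Spec B) hy => ?_) hdvd
  have := (hU.stalk_of_mem hy).2
  exact .of_equiv (IsLocalization.algEquiv y.asIdeal.primeCompl
    ((Spec B).presheaf.stalk y) (Localization.AtPrime y.asIdeal)).toRingEquiv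

variable [IsNoetherianRing A] [IrreducibleSpace (Spec A)] {f : B ⟶ A} {U : (Spec B).Opens}

theorem SatisfiesS.isDomain_of_isNormalScheme (hS : SatisfiesS 1 (Spec A))
    (hf : Function.Injective f) (hU : IsNormalScheme U)
    (hZ : 1 ≤ codim (Spec.map f ⁻¹' (U : Set (Spec B))ᶜ)) : IsDomain B := by
  set y := Spec.map f (genericPoint (Spec A))
  have hyU : y ∈ U := by
    by_contra hy
    exact one_le_codim_iff.1 hZ _ hy isMax_genericPoint
  have hreg : y.asIdeal.primeCompl ≤ B⁰ := fun s hs =>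
    comap_nonZeroDivisors_le_of_injective hf <|
      hS.mem_nonZeroDivisors_of_not_isNilpotent fun hfs =>
        hs (nilpotent_iff_mem_prime.1 hfs _ (isPrime_asIdeal _))
  have := (hU.stalk_of_mem hyU).1
  exact (IsLocalization.injective ((Spec B).presheaf.stalk y) hreg).isDomain (algebraMap _ _)

theorem SatisfiesS.isNormalScheme_spec (hS : SatisfiesS 2 (Spec A)) (hf : Function.Injective f)
    (hdvd : ∀ a b : B, f b ∈ A⁰ → f b ∣ f a → b ∣ a) (hU : IsNormalScheme U)
    (hZ : 2 ≤ codim (Spec.map f ⁻¹' (U : Set (Spec B))ᶜ)) : IsNormalScheme (Spec B) := by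
  have hS₁ : SatisfiesS 1 (Spec A) := hS.mono one_le_two
  have : IsDomain B := hS₁.isDomain_of_isNormalScheme hf hU (one_le_two.trans hZ)
  have hZc : IsClosed (Spec.map f ⁻¹' (U : Set (Spec B))ᶜ) :=
    U.isOpen.isClosed_compl.preimage (Spec.map f).continuous
  have : IsIntegrallyClosed B := by
    refine isIntegrallyClosed_of_isNormalScheme_of_forall_dvd hU fun a b hb hab => ?_
    have hfb : f b ∈ A⁰ := hS₁.mem_nonZeroDivisors_of_not_isNilpotent fun hfb =>
      hb ((IsNilpotent.map_iff hf).1 hfb).eq_zero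
    refine hdvd a b hfb (hS.dvd_of_forall_exists_notMem_dvd_mul hZc hZ hfb fun x hx => ?_)
    obtain ⟨s, hs, hsa⟩ := hab (Spec.map f x) (not_not.1 hx)
    exact ⟨f s, hs, by simpa using map_dvd f.hom hsa⟩
  exact isNormalScheme_spec_of_isIntegrallyClosed

end Descent

end Spec

end QuotNormal

theorem corollary7p2_general
    {K : Type*} [Field K] {n : ℕ} {G : Subgroup (GL (Fin n) K)}
    {A : Type*} [CommRing A] [Algebra K A] [IsNoetherianRing A]
    (hX : IrreducibleSpace (Spec (CommRingCat.of A)))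
    (α : QuotNormal.Action G A)
    (U : α.quotient.Opens)
    (hU : QuotNormal.IsNormalScheme U)
    (hpiZ : 2 ≤ QuotNormal.codim (α.quotientMap ⁻¹' ((U : Set α.quotient)ᶜ)))
    (hS : QuotNormal.SatisfiesS 2 (Spec (CommRingCat.of A))) :
    QuotNormal.IsNormalScheme α.quotient := by
  have : IsNoetherianRing (CommRingCat.of A) := ‹_›
  exact hS.isNormalScheme_spec (f := CommRingCat.ofHom (algebraMap α.invariants A))
    Subtype.val_injective (fun _ _ => α.dvd_of_coe_dvd_coe) hU hpiZ

theorem corollary7p2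
    {K : Type*} [Field K] [IsAlgClosed K] [CharZero K]
    {n : ℕ} {G : Subgroup (GL (Fin n) K)} (hG : QuotNormal.IsReductive G)
    {A : Type*} [CommRing A] [Algebra K A] (hA : Algebra.FiniteType K A)
    (hX : IrreducibleSpace (Spec (CommRingCat.of A)))
    (α : QuotNormal.Action G A)
    (U : α.quotient.Opens)
    (hU : QuotNormal.IsNormalScheme U)
    (hZ : 2 ≤ QuotNormal.codim ((U : Set α.quotient)ᶜ))
    (hpiZ : 2 ≤ QuotNormal.codim (α.quotientMap ⁻¹' ((U : Set α.quotient)ᶜ)))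
    (hS : QuotNormal.SatisfiesS 2 (Spec (CommRingCat.of A))) :
    QuotNormal.IsNormalScheme α.quotient :=
  have : IsNoetherianRing A := Algebra.FiniteType.isNoetherianRing K A
  corollary7p2_general hX α U hU hpiZ hS
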